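/- Let $\mathbb D=\{z\in\mathbb C:|z|<1\}$. Let $\mathcal A$ be the class of analytic functions $f(z)=z+\sum_{n\ge2}a_nz^n$ in $\mathbb D$, and let $\mathcal K$ be the class of convex univalent functions, i.e. of those $f\in\mathcal A$ with $f'\neq0$ and $\operatorname{Re}\{1+zf''(z)/f'(z)\}>0$ in $\mathbb D$. For $|\zeta|\le1$ let $$d_\zeta f(z)=\frac1z\Big\{f(z)*\frac{z}{(1-\zeta z)(1-z)}\Big\}=1+\sum_{n\ge2}(1+\zeta+\dots+\zeta^{n-1})\,a_nz^{n-1},$$ where $*$ is the Hadamard product $\big(\sum_n a_nz^n\big)*\big(\sum_n b_nz^n\big)=\sum_n a_nb_nz^n$, and the value at $z=0$ is $d_\zeta f(0)=f'(0)=1$. **Corollary.** (a) Let $f\in\mathcal K$, $z\in\mathbb D$, $|\zeta|\le1$ and $\zeta\ne1$. Then $d_\zeta f(z)\ne0$, $$\operatorname{Re}\Big\{\frac{f'(z)}{(1-\zeta)\,d_\zeta f(z)}\Big\}>\operatorname{Re}\Big\{\frac{1+\zeta}{2(1-\zeta)}\Big\}\qquad(1)$$ and $$\operatorname{Re}\Big\{\frac1{1-\zeta}\Big(\frac{f'(z)}{d_\zeta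 f(z)}-1\Big)\Big\}>-\frac12.\qquad(2)$$ The right-hand side of (1) is positive if $|\zeta|<1$, and it is $0$ if $|\zeta|=1$, $\zeta\neq1$. (b) For any $f\in\mathcal A$, $z\in\mathbb D$ and $|\zeta|\le 1$, $\zeta\ne1$, with $d_\zeta f(z)\ne0$, the inequalities (1) and (2) are equivalent. (c) For $f\in\mathcal K$ and $z\in\mathbb D$ one has $d_1f(z)=f'(z)$; as $\zeta\to1$ with $|\zeta|\le1$, $\zeta\ne1$, the expression in braces in (2) tends to $\frac{zf''(z)}{2f'(z)}$, and (2) also holds for $\zeta=1$ in the sense that $\operatorname{Re}\frac{zf''(z)}{2f'(z)}>-\frac12$. (d) The bounds are best possible: there is one function $f\in\mathcal K$ such that for every $\zeta$ with $|\zeta|\le1$, $\zeta\ne1$, the infimum over $z\in\mathbb D$ of the left-hand side of (1) equals $\operatorname{Re}\frac{1+\zeta}{2(1-\zeta)}$ and the infimum over $z\in\mathbb D$ of the left-hand side of (2) equals $-\frac12$, and also $\inf_{z\in\mathbb D}\operatorname{Re}\frac{zf''(z)}{2f'(z)}=-\frac12$. -/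

import Mathlib

open Complex Metric Filter Topology

noncomputable section

namespace ZetaDerivative

/-- The class `𝒜`: functions analytic in the open unit disc with `f 0 = 0` and `f' 0 = 1`.
Values outside the disc are irrelevant. -/
def ClassA (f : ℂ → ℂ) : Prop :=
  AnalyticOnNhd ℂ f (ball 0 1) ∧ f 0 = 0 ∧ deriv f 0 = 1

/-- The class `𝒦` of convex univalent functions: `f ∈ 𝒜` with `Re (1 + z f''(z) / f'(z)) > 0`
in the unit disc. That `f'` has no zero there, so that the quotient is meaningful, is made
explicit. -/
def ClassK (f : ℂ → ℂ) : Prop :=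
  ClassA f ∧ ∀ z ∈ ball (0 : ℂ) 1,
    deriv f z ≠ 0 ∧ 0 < (1 + z * deriv (deriv f) z / deriv f z).re

/-- The `n`-th Taylor coefficient of `f` at the origin. -/
def taylorCoeff (f : ℂ → ℂ) (n : ℕ) : ℂ :=
  iteratedDeriv n f 0 / (n.factorial : ℂ)

/-- The Hadamard product (convolution) `(f * g)(z) = ∑ aₙ bₙ zⁿ` of `f(z) = ∑ aₙ zⁿ` and
`g(z) = ∑ bₙ zⁿ`. -/
def hadamard (f g : ℂ → ℂ) (z : ℂ) : ℂ :=
  ∑' n : ℕ, taylorCoeff f n * taylorCoeff g n * z ^ n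

/-- The function `h_ζ(z) = z / ((1 - ζ z) (1 - z))`. -/
def hFun (ζ : ℂ) (z : ℂ) : ℂ :=
  z / ((1 - ζ * z) * (1 - z))

/-- The `ζ`-derivative `d_ζ f(z) = (1 / z) (f * h_ζ)(z)`, with its removable singularity at
the origin filled in: there the value is the coefficient of `z` in `f * h_ζ`, which is `f' 0`. -/
def zetaDeriv (ζ : ℂ) (f : ℂ → ℂ) (z : ℂ) : ℂ :=
  if z = 0 then deriv f 0 else (1 / z) * hadamard f (hFun ζ) z

end ZetaDerivative

end

namespace ZetaDerivative

/-! For `ζ ≠ 1` and `z ≠ 0`, `d_ζ f(z) = (f(z) - f(ζz)) / ((1 - ζ) z)`. With `w = ζz`, inequality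
(1) becomes `Re (z + w)/(z - w) < Re 2z f'(z)/(f(z) - f(w))` for `|w| ≤ |z|`, `w ≠ z`
(`re_add_div_sub_lt`). On `|w| = |z|` the left side is `0`, and the claim is that the image of the
circle lies strictly on one side of its tangent at `f(z)`. This holds because the tangent direction
turns monotonically, by `2π` in all (`re_sub_mul_conj_neg_of_norm_eq`). Inside the circle, the
difference of the two sides is harmonic in `w`, its singularity at `w = z` is removable with value
`Re (1 + z f''/f') > 0`, and the maximum principle applies. (1) and (2) differ by the constant `Re
1/(1 - ζ)`. For `z/(1 - z)` the expression in (2) is `z/(1 - z)` itself, whatever `ζ`, which gives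
sharpness. -/

/-! ### The `ζ`-derivative as a difference quotient. -/

theorem taylorCoeff_eq_of_hasSum {f : ℂ → ℂ} {c : ℕ → ℂ}
    (h : ∀ᶠ z in 𝓝 (0 : ℂ), HasSum (fun n => c n * z ^ n) (f z)) (n : ℕ) :
    taylorCoeff f n = c n := by
  have h1 : HasFPowerSeriesAt f (FormalMultilinearSeries.ofScalars ℂ c) 0 := by
    rw [hasFPowerSeriesAt_iff]
    filter_upwards [h] with z hz
    simpa [FormalMultilinearSeries.coeff_ofScalars, mul_comm] using hz
  have h2 := h1.analyticAt.hasFPowerSeriesAt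
  have h3 := congrArg (fun p => p.coeff n) (h2.eq_formalMultilinearSeries h1)
  simpa [FormalMultilinearSeries.coeff_ofScalars, taylorCoeff] using h3

theorem taylorCoeff_hFun (ζ : ℂ) (n : ℕ) :
    taylorCoeff (hFun ζ) n = ∑ k ∈ Finset.range n, ζ ^ k := by
  refine taylorCoeff_eq_of_hasSum (c := fun n => ∑ k ∈ Finset.range n, ζ ^ k) ?_ n
  have hb : ∀ᶠ z in 𝓝 (0 : ℂ), ‖z‖ < 1 := by
    have : Tendsto (fun z : ℂ => ‖z‖) (𝓝 0) (𝓝 0) := by simpa using (continuous_norm.tendsto (0 : ℂ))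
    exact this.eventually_lt_const one_pos
  have hc : ∀ᶠ z in 𝓝 (0 : ℂ), ‖ζ * z‖ < 1 := by
    have : Tendsto (fun z : ℂ => ‖ζ * z‖) (𝓝 0) (𝓝 0) := by
      have : Continuous (fun z : ℂ => ‖ζ * z‖) := by fun_prop
      simpa using this.tendsto 0
    exact this.eventually_lt_const one_pos
  filter_upwards [hb, hc] with z hz hζz
  have hne : 1 - z ≠ 0 := by
    intro h0
    rw [← sub_eq_zero.mp h0] at hz
    simp at hz
  have hne' : 1 - ζ * z ≠ 0 := by
    intro h0
    rw [← sub_eq_zero.mp h0] at hζz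
    simp at hζz
  unfold hFun
  by_cases h1 : ζ = 1
  · subst h1
    simpa [pow_two] using hasSum_coe_mul_geometric_of_norm_lt_one hz
  · have h1' : ζ - 1 ≠ 0 := sub_ne_zero.mpr h1
    have key := ((hasSum_geometric_of_norm_lt_one hζz).sub
      (hasSum_geometric_of_norm_lt_one hz)).mul_left (1 / (ζ - 1))
    convert! key using 1
    · funext m
      rw [geom_sum_eq h1, mul_pow]
      ring
    · rw [inv_sub_inv hne' hne]
      field_simp
      ring

theorem hasSum_taylorCoeff {f : ℂ → ℂ} (hf : DifferentiableOn ℂ f (ball 0 1)) {z : ℂ}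
    (hz : z ∈ ball (0 : ℂ) 1) : HasSum (fun n => taylorCoeff f n * z ^ n) (f z) := by
  convert! Complex.hasSum_taylorSeries_on_ball hf hz using 2 with n
  simp [taylorCoeff, div_eq_mul_inv]
  ring

theorem mul_mem_ball {ζ z : ℂ} (hζ : ‖ζ‖ ≤ 1) (hz : z ∈ ball (0 : ℂ) 1) :
    ζ * z ∈ ball (0 : ℂ) 1 := by
  rw [mem_ball_zero_iff] at *
  rw [norm_mul]
  exact (mul_le_of_le_one_left (norm_nonneg z) hζ).trans_lt hz

theorem zetaDeriv_zero (ζ : ℂ) (f : ℂ → ℂ) : zetaDeriv ζ f 0 = deriv f 0 := by simp [zetaDeriv]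

theorem zetaDeriv_eq {f : ℂ → ℂ} (hf : DifferentiableOn ℂ f (ball 0 1)) {z ζ : ℂ}
    (hz : z ∈ ball (0 : ℂ) 1) (hζ : ‖ζ‖ ≤ 1) (h1 : ζ ≠ 1) (h0 : z ≠ 0) :
    zetaDeriv ζ f z = (f z - f (ζ * z)) / ((1 - ζ) * z) := by
  have h1' : ζ - 1 ≠ 0 := sub_ne_zero.mpr h1
  have h1'' : 1 - ζ ≠ 0 := sub_ne_zero.mpr h1.symm
  have key := ((hasSum_taylorCoeff hf (mul_mem_ball hζ hz)).sub
    (hasSum_taylorCoeff hf hz)).mul_left (1 / (ζ - 1))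
  have : hadamard f (hFun ζ) z = 1 / (ζ - 1) * (f (ζ * z) - f z) := by
    rw [hadamard, ← key.tsum_eq]
    congr 1
    funext n
    rw [taylorCoeff_hFun, geom_sum_eq h1, mul_pow]
    ring
  rw [zetaDeriv, if_neg h0, this]
  field_simp
  ring

theorem hasSum_deriv {f : ℂ → ℂ} (hf : DifferentiableOn ℂ f (ball 0 1)) {z : ℂ}
    (hz : z ∈ ball (0 : ℂ) 1) : HasSum (fun n => taylorCoeff f n * n * z ^ n) (z * deriv f z) := by
  have hd : DifferentiableOn ℂ (deriv f) (ball 0 1) := hf.deriv isOpen_ball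
  have h := ((hasSum_taylorCoeff hd hz).mul_left z)
  rw [← hasSum_nat_add_iff' 1]
  simp only [Finset.range_one, Finset.sum_singleton, Nat.cast_zero, mul_zero, zero_mul, sub_zero]
  convert! h using 2 with n
  simp only [taylorCoeff, iteratedDeriv_succ', Nat.factorial_succ, Nat.cast_mul, Nat.cast_succ]
  have : (n : ℂ) + 1 ≠ 0 := Nat.cast_add_one_ne_zero n
  have : (n.factorial : ℂ) ≠ 0 := Nat.cast_ne_zero.mpr n.factorial_ne_zero
  field_simp
  ring

theorem zetaDeriv_one {f : ℂ → ℂ} (hf : DifferentiableOn ℂ f (ball 0 1)) {z : ℂ}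
    (hz : z ∈ ball (0 : ℂ) 1) : zetaDeriv 1 f z = deriv f z := by
  by_cases h0 : z = 0
  · rw [h0, zetaDeriv_zero]
  · have : hadamard f (hFun 1) z = z * deriv f z := by
      rw [hadamard, ← (hasSum_deriv hf hz).tsum_eq]
      congr 1
      funext n
      simp [taylorCoeff_hFun]
    rw [zetaDeriv, if_neg h0, this]
    field_simp

/-! ### Divided differences and the limit `ζ → 1`. -/

theorem differentiableOn_dslope_ball {f : ℂ → ℂ} (hf : DifferentiableOn ℂ f (ball 0 1)) {z : ℂ}
    (hz : z ∈ ball (0 : ℂ) 1) : DifferentiableOn ℂ (dslope f z) (ball 0 1) :=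
  (Complex.differentiableOn_dslope (isOpen_ball.mem_nhds hz)).mpr hf

theorem deriv_dslope_self {f : ℂ → ℂ} (hf : DifferentiableOn ℂ f (ball 0 1)) {z : ℂ}
    (hz : z ∈ ball (0 : ℂ) 1) : deriv (dslope f z) z = deriv (deriv f) z / 2 := by
  have hD := differentiableOn_dslope_ball hf hz
  have hD' := hD.deriv isOpen_ball
  have hat : ∀ u ∈ ball (0 : ℂ) 1, DifferentiableAt ℂ (dslope f z) u := fun u hu =>
    hD.differentiableAt (isOpen_ball.mem_nhds hu)
  have hfeq : f = fun u => f z + (u - z) * dslope f z u := by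
    funext u
    have := sub_smul_dslope f z u
    rw [smul_eq_mul] at this
    rw [this]
    ring
  have h1 : deriv f =ᶠ[𝓝 z] fun u => dslope f z u + (u - z) * deriv (dslope f z) u := by
    filter_upwards [isOpen_ball.mem_nhds hz] with u hu
    have := (((hasDerivAt_id u).sub_const z).mul (hat u hu).hasDerivAt).const_add (f z)
    have h2 : HasDerivAt (fun u => f z + (u - z) * dslope f z u)
      (1 * dslope f z u + (u - z) * deriv (dslope f z) u) u := this
    rw [← hfeq] at h2
    rw [h2.deriv, one_mul]
  rw [h1.deriv_eq]
  have h3 := (hat z hz).hasDerivAt.add (((hasDerivAt_id z).sub_const z).mul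
    (hD'.differentiableAt (isOpen_ball.mem_nhds hz)).hasDerivAt)
  have h4 : deriv (fun u => dslope f z u + (u - z) * deriv (dslope f z) u) z =
      deriv (dslope f z) z + (1 * deriv (dslope f z) z + (z - z) * deriv (deriv (dslope f z)) z) :=
    h3.deriv
  rw [h4]
  ring

theorem zetaDeriv_eq_dslope {f : ℂ → ℂ} (hf : DifferentiableOn ℂ f (ball 0 1)) {z ζ : ℂ}
    (hz : z ∈ ball (0 : ℂ) 1) (hζ : ‖ζ‖ ≤ 1) (h1 : ζ ≠ 1) (h0 : z ≠ 0) :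
    zetaDeriv ζ f z = dslope f z (ζ * z) := by
  have h1'' : 1 - ζ ≠ 0 := sub_ne_zero.mpr h1.symm
  have h1' : ζ - 1 ≠ 0 := sub_ne_zero.mpr h1
  have hne : ζ * z ≠ z := by
    intro h
    exact h1 (mul_right_cancel₀ h0 (h.trans (one_mul z).symm))
  rw [zetaDeriv_eq hf hz hζ h1 h0, dslope_of_ne _ hne, slope_def_field,
    show ζ * z - z = (ζ - 1) * z by ring]
  field_simp
  ring

/-- With `D` and `E` the first and second divided differences of `f` at `z`, `D(ζz) - f'(z) = (ζ -
1) z E(ζz)`, so the expression is `z E(ζz) / D(ζz)` for `z ≠ 0` and `ζ` near `1`. -/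
theorem tendsto_quotient {f : ℂ → ℂ} (hf : DifferentiableOn ℂ f (ball 0 1)) {z : ℂ}
    (hz : z ∈ ball (0 : ℂ) 1) (hd : deriv f z ≠ 0) :
    Tendsto (fun ζ : ℂ => 1 / (1 - ζ) * (deriv f z / zetaDeriv ζ f z - 1))
      (𝓝[closedBall (0 : ℂ) 1 \ {1}] 1) (𝓝 (z * deriv (deriv f) z / (2 * deriv f z))) := by
  by_cases h0 : z = 0
  · subst h0
    simp only [zetaDeriv_zero, div_self hd, sub_self, mul_zero, zero_mul, zero_div]
    exact tendsto_const_nhds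
  have hD := differentiableOn_dslope_ball hf hz
  have hE := differentiableOn_dslope_ball hD hz
  have hm : Tendsto (fun ζ : ℂ => ζ * z) (𝓝 1) (𝓝 z) := by
    have : Continuous (fun ζ : ℂ => ζ * z) := by fun_prop
    simpa using this.tendsto 1
  have hDt := (hD.differentiableAt (isOpen_ball.mem_nhds hz)).continuousAt.tendsto.comp hm
  have hEt := (hE.differentiableAt (isOpen_ball.mem_nhds hz)).continuousAt.tendsto.comp hm
  rw [dslope_same] at hDt hEt
  rw [deriv_dslope_self hf hz] at hEt
  have hlim := ((hEt.const_mul z).div hDt hd).mono_left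
    (nhdsWithin_le_nhds (s := closedBall (0 : ℂ) 1 \ {1}))
  rw [show z * (deriv (deriv f) z / 2) / deriv f z = z * deriv (deriv f) z / (2 * deriv f z) by
    field_simp] at hlim
  refine hlim.congr' ?_
  filter_upwards [self_mem_nhdsWithin, nhdsWithin_le_nhds (hDt.eventually_ne hd)] with ζ hζ hne
  have hζ1 : ζ ≠ 1 := hζ.2
  have hζn : ‖ζ‖ ≤ 1 := mem_closedBall_zero_iff.mp hζ.1
  have h1 : 1 - ζ ≠ 0 := sub_ne_zero.mpr hζ1.symm
  rw [zetaDeriv_eq_dslope hf hz hζn hζ1 h0]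
  have h2 := sub_smul_dslope (dslope f z) z (ζ * z)
  rw [dslope_same, smul_eq_mul] at h2
  simp only [Function.comp_apply] at hne
  simp only [Function.comp_apply, Pi.div_apply]
  generalize dslope (dslope f z) z (ζ * z) = E at *
  generalize dslope f z (ζ * z) = D at *
  field_simp
  linear_combination -h2

/-! ### The tangent-line inequality on a circle. -/

/-- A logarithm of a nonvanishing holomorphic function on the disc, up to a constant factor. -/
theorem exists_eq_mul_exp {p : ℂ → ℂ} (hp : DifferentiableOn ℂ p (ball 0 1))
    (hne : ∀ z ∈ ball (0 : ℂ) 1, p z ≠ 0) :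
    ∃ (c : ℂ) (g : ℂ → ℂ), c ≠ 0 ∧ ∀ z ∈ ball (0 : ℂ) 1,
      HasDerivAt g (deriv p z / p z) z ∧ p z = c * exp (g z) := by
  obtain ⟨g, hg⟩ := ((hp.deriv isOpen_ball).div hp hne).isExactOn_ball
  have hq : ∀ z ∈ ball (0 : ℂ) 1, HasDerivAt (fun z => p z * exp (-g z)) 0 z := by
    intro z hz
    have h := (hp.differentiableAt (isOpen_ball.mem_nhds hz)).hasDerivAt.mul (hg z hz).neg.cexp
    convert! h using 1
    have := hne z hz
    simp only [Pi.div_apply]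
    field_simp
    ring
  have hconst : ∀ z ∈ ball (0 : ℂ) 1, p z * exp (-g z) = p 0 * exp (-g 0) := by
    intro z hz
    exact isOpen_ball.is_const_of_deriv_eq_zero (convex_ball (0 : ℂ) 1).isPreconnected
      (fun w hw => (hq w hw).differentiableAt.differentiableWithinAt)
      (fun w hw => (hq w hw).deriv) hz (mem_ball_self one_pos)
  refine ⟨p 0 * exp (-g 0), g, mul_ne_zero (hne 0 (mem_ball_self one_pos)) (exp_ne_zero _),
    fun z hz => ⟨hg z hz, ?_⟩⟩
  rw [← hconst z hz, mul_assoc, ← exp_add]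
  simp

theorem exists_eq_mul_exp_I {z w : ℂ} (hz : z ≠ 0) (hw : ‖w‖ = ‖z‖) (hne : w ≠ z) :
    ∃ θ : ℝ, 0 < θ ∧ θ < 2 * Real.pi ∧ w = z * exp (θ * I) := by
  have hn : ‖w / z‖ = 1 := by
    rw [norm_div, hw, div_self (norm_ne_zero_iff.mpr hz)]
  have h := norm_mul_exp_arg_mul_I (w / z)
  rw [hn, ofReal_one, one_mul] at h
  have hwz : w = z * exp (arg (w / z) * I) := by
    rw [h]
    field_simp
  have hpi := Real.pi_pos
  rcases lt_trichotomy (arg (w / z)) 0 with h0 | h0 | h0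
  · refine ⟨arg (w / z) + 2 * Real.pi, by linarith [neg_pi_lt_arg (w / z)], by linarith, hwz.trans ?_⟩
    push_cast
    rw [add_mul, exp_add, exp_two_pi_mul_I, mul_one]
  · exfalso
    apply hne
    rw [hwz, h0]
    simp
  · exact ⟨arg (w / z), h0, by linarith [arg_le_pi (w / z)], hwz⟩

/-- The curve `f (|z| = r)` lies strictly on one side of its tangent line at `f z`. -/
theorem re_sub_mul_conj_neg_of_norm_eq {f : ℂ → ℂ} (hf : ClassK f) {z w : ℂ}
    (hz : z ∈ ball (0 : ℂ) 1) (h0 : z ≠ 0) (hw : ‖w‖ = ‖z‖) (hne : w ≠ z) :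
    ((f w - f z) * (starRingEnd ℂ) (z * deriv f z)).re < 0 := by
  have hd : DifferentiableOn ℂ f (ball 0 1) := hf.1.1.differentiableOn
  obtain ⟨c, g, hc, hg⟩ := exists_eq_mul_exp (hd.deriv isOpen_ball) (fun z hz => (hf.2 z hz).1)
  obtain ⟨θ, hθ0, hθ1, rfl⟩ := exists_eq_mul_exp_I h0 hw hne
  set e : ℝ → ℂ := fun t => z * exp (t * I) with he
  have hmem : ∀ t, e t ∈ ball (0 : ℂ) 1 := by
    intro t
    rw [mem_ball_zero_iff] at *
    simpa [he, norm_exp_ofReal_mul_I] using hz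
  have he0 : e 0 = z := by simp [he]
  have he1 : e (2 * Real.pi) = z := by simp [he, exp_two_pi_mul_I]
  have hed : ∀ t, HasDerivAt e (e t * I) t := by
    intro t
    have h1 : HasDerivAt (fun t : ℝ => (t : ℂ) * I) I t := by
      simpa using (hasDerivAt_id t).ofReal_comp.mul_const I
    have := (h1.cexp).const_mul z
    simpa [he, mul_assoc] using this
  -- The angle through which the tangent has turned: a continuous branch of the argument of `e t *
  -- f'(e t)`, normalised to vanish at `t = 0`. Its derivative is the quantity that is positive in
  -- the class `𝒦`.
  set ψ : ℝ → ℝ := fun t => t + (g (e t)).im - (g z).im with hψ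
  have hψd : ∀ t, HasDerivAt ψ (1 + e t * deriv (deriv f) (e t) / deriv f (e t)).re t := by
    intro t
    have h1 := (hg _ (hmem t)).1.comp t (hed t)
    have h2 := imCLM.hasFDerivAt.comp_hasDerivAt t h1
    have h3 := ((hasDerivAt_id t).add h2).sub_const (g z).im
    convert! h3 using 1
    simp only [imCLM_apply, add_re, one_re]
    rw [show deriv (deriv f) (e t) / deriv f (e t) * (e t * I) =
      (e t * deriv (deriv f) (e t) / deriv f (e t)) * I by ring, mul_I_im]
  have hψm : StrictMono ψ := strictMono_of_deriv_pos fun t => by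
    rw [(hψd t).deriv]
    exact (hf.2 _ (hmem t)).2
  have hψ0 : ψ 0 = 0 := by simp [hψ, he0]
  have hψ1 : ψ (2 * Real.pi) = 2 * Real.pi := by simp only [hψ, he1]; ring
  set h : ℝ → ℝ := fun t => ((f (e t) - f z) * (starRingEnd ℂ) (z * deriv f z)).re with hh
  -- The velocity `i e f'(e)` times the conjugate of `z f'(z)` is a positive multiple of `i
  -- exp(iψ)`.
  have hhd : ∀ t, ∃ k : ℝ, 0 < k ∧ HasDerivAt h (-(k * Real.sin (ψ t))) t := by
    intro t
    have hzc : 0 < ‖z * c‖ := norm_pos_iff.mpr (mul_ne_zero h0 hc)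
    refine ⟨‖z * c‖ ^ 2 * Real.exp ((g (e t)).re + (g z).re), by positivity, ?_⟩
    have h1 := (hd.differentiableAt (isOpen_ball.mem_nhds (hmem t))).hasDerivAt.comp t (hed t)
    have h2 := reCLM.hasFDerivAt.comp_hasDerivAt t
      ((h1.sub_const (f z)).mul_const ((starRingEnd ℂ) (z * deriv f z)))
    convert! h2 using 1
    have key : deriv f (e t) * (e t * I) * (starRingEnd ℂ) (z * deriv f z) =
        (‖z * c‖ ^ 2 : ℝ) * (exp (t * I + g (e t) + (starRingEnd ℂ) (g z)) * I) := by
      rw [(hg _ (hmem t)).2, (hg z hz).2, ofReal_pow, ← mul_conj']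
      simp only [map_mul, ← exp_conj, exp_add, he]
      ring
    rw [reCLM_apply, key, re_ofReal_mul, mul_I_re, exp_im]
    simp only [add_re, add_im, mul_I_re, mul_I_im, ofReal_re, ofReal_im, conj_re, conj_im, hψ]
    rw [neg_zero, zero_add, ← sub_eq_add_neg]
    ring
  have hcont : Continuous h := continuous_iff_continuousAt.mpr fun t =>
    (hhd t).choose_spec.2.continuousAt
  have hh0 : h 0 = 0 := by simp [hh, he0]
  have hh1 : h (2 * Real.pi) = 0 := by simp [hh, he1]
  change h θ < 0
  -- `h` vanishes at `0` and `2π`, falls while `ψ < π` and rises afterwards; `θ` is compared with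
  -- the endpoint on its side.
  rcases le_or_gt (ψ θ) Real.pi with hcase | hcase
  · have : StrictAntiOn h (Set.Icc 0 θ) := by
      refine strictAntiOn_of_deriv_neg (convex_Icc 0 θ) hcont.continuousOn ?_
      intro t ht
      rw [interior_Icc] at ht
      obtain ⟨k, hk, hkd⟩ := hhd t
      rw [hkd.deriv]
      have := Real.sin_pos_of_pos_of_lt_pi (hψ0 ▸ hψm ht.1) ((hψm ht.2).trans_le hcase)
      have := mul_pos hk this
      linarith
    rw [← hh0]
    exact this (Set.left_mem_Icc.mpr hθ0.le) (Set.right_mem_Icc.mpr hθ0.le) hθ0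
  · have : StrictMonoOn h (Set.Icc θ (2 * Real.pi)) := by
      refine strictMonoOn_of_deriv_pos (convex_Icc _ _) hcont.continuousOn ?_
      intro t ht
      rw [interior_Icc] at ht
      obtain ⟨k, hk, hkd⟩ := hhd t
      rw [hkd.deriv]
      have h1 : ψ t < 2 * Real.pi := hψ1 ▸ hψm ht.2
      have h2 : Real.pi < ψ t := hcase.trans (hψm ht.1)
      have h3 := Real.sin_neg_of_neg_of_neg_pi_lt (x := ψ t - 2 * Real.pi) (by linarith)
        (by linarith)
      rw [Real.sin_sub_two_pi] at h3
      nlinarith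
    rw [← hh1]
    exact this (Set.left_mem_Icc.mpr hθ1.le) (Set.right_mem_Icc.mpr hθ1.le) hθ1

/-! ### From the circle to the disc by the maximum principle. -/

/-- The strict maximum principle for the real part of a holomorphic function on a disc. -/
theorem re_neg_of_sphere {g : ℂ → ℂ} {r : ℝ} (hg : DiffContOnCl ℂ g (ball 0 r)) {a : ℂ}
    (hb : ∀ w, ‖w‖ = r → (g w).re ≤ 0) (ha : ‖a‖ = r) (hga : (g a).re < 0) {w : ℂ}
    (hw : w ∈ ball (0 : ℂ) r) : (g w).re < 0 := by
  have hr : r ≠ 0 := (pos_of_mem_ball hw).ne'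
  -- Since `‖exp g‖ = exp (Re g)`, the maximum modulus principle controls `Re g`.
  have hexp : DiffContOnCl ℂ (fun w => exp (g w)) (ball 0 r) :=
    ⟨hg.differentiableOn.cexp, hg.continuousOn.cexp⟩
  have hle : ∀ u ∈ closure (ball (0 : ℂ) r), ‖exp (g u)‖ ≤ 1 := fun u hu =>
    norm_le_of_forall_mem_frontier_norm_le isBounded_ball hexp (by
      intro v hv
      rw [frontier_ball _ hr, mem_sphere_zero_iff_norm] at hv
      rw [norm_exp, Real.exp_le_one_iff]
      exact hb v hv) hu
  by_contra hcon
  have h1 : 1 ≤ ‖exp (g w)‖ := by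
    rw [norm_exp]
    exact Real.one_le_exp (not_lt.mp hcon)
  have hmax : IsMaxOn (norm ∘ fun w => exp (g w)) (ball 0 r) w := fun u hu =>
    (hle u (subset_closure hu)).trans h1
  have h2 := norm_eqOn_closure_of_isPreconnected_of_isMaxOn (convex_ball (0 : ℂ) r).isPreconnected
    isOpen_ball hexp hw hmax (x := a) (by
      rw [closure_ball _ hr, mem_closedBall_zero_iff]
      exact ha.le)
  simp only [Function.comp_apply, Function.const_apply] at h2
  rw [← h2, norm_exp, Real.one_le_exp_iff] at h1
  linarith

/-- The expression is the real part of a function holomorphic in `w`, strictly negative at the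
boundary point `-z`. In particular `f w ≠ f z`, so the later quotients have no poles. -/
theorem re_sub_mul_conj_neg {f : ℂ → ℂ} (hf : ClassK f) {z w : ℂ}
    (hz : z ∈ ball (0 : ℂ) 1) (h0 : z ≠ 0) (hw : ‖w‖ ≤ ‖z‖) (hne : w ≠ z) :
    ((f w - f z) * (starRingEnd ℂ) (z * deriv f z)).re < 0 := by
  rcases hw.eq_or_lt with h | h
  · exact re_sub_mul_conj_neg_of_norm_eq hf hz h0 h hne
  have hr : ‖z‖ ≠ 0 := norm_ne_zero_iff.mpr h0
  have hsub : closure (ball (0 : ℂ) ‖z‖) ⊆ ball 0 1 := by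
    rw [closure_ball _ hr]
    exact closedBall_subset_ball (mem_ball_zero_iff.mp hz)
  have hd : DiffContOnCl ℂ (fun w => (f w - f z) * (starRingEnd ℂ) (z * deriv f z))
      (ball 0 ‖z‖) :=
    ((((hf.1.1.differentiableOn).mono hsub).sub_const _).mul_const _).diffContOnCl
  refine re_neg_of_sphere hd (a := -z) ?_ (norm_neg z) ?_ (mem_ball_zero_iff.mpr h)
  · intro u hu
    by_cases huz : u = z
    · simp [huz]
    · exact (re_sub_mul_conj_neg_of_norm_eq hf hz h0 hu huz).le
  · exact re_sub_mul_conj_neg_of_norm_eq hf hz h0 (norm_neg z) (neg_ne_self.mpr h0)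

theorem re_div_eq (a b : ℂ) : (a / b).re = (b * (starRingEnd ℂ) a).re / normSq b := by
  simp [div_re, mul_re]
  ring

theorem re_add_div_sub_lt_of_norm_eq {f : ℂ → ℂ} (hf : ClassK f) {z w : ℂ}
    (hz : z ∈ ball (0 : ℂ) 1) (h0 : z ≠ 0) (hw : ‖w‖ = ‖z‖) (hne : w ≠ z) :
    ((z + w) / (z - w)).re < (2 * z * deriv f z / (f z - f w)).re := by
  have h1 : ((z + w) / (z - w)).re = 0 := by
    have h2 : normSq w = normSq z := by rw [normSq_eq_norm_sq, normSq_eq_norm_sq, hw]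
    rw [normSq_apply, normSq_apply] at h2
    rw [re_div_eq, div_eq_zero_iff]
    left
    simp [mul_re]
    linarith
  have h3 := re_sub_mul_conj_neg hf hz h0 hw.le hne
  have h4 : f z - f w ≠ 0 := by
    intro h
    rw [← neg_sub, h] at h3
    simp at h3
  rw [h1, mul_assoc, mul_div_assoc, show (2 : ℂ) = ((2 : ℝ) : ℂ) by norm_num, re_ofReal_mul,
    re_div_eq, ← neg_sub (f w), neg_mul, neg_re]
  have h5 : 0 < normSq (-(f w - f z)) := normSq_pos.mpr (by rwa [neg_sub])
  have := div_pos (neg_pos.mpr h3) h5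
  linarith

theorem re_add_div_sub_lt {f : ℂ → ℂ} (hf : ClassK f) {z w : ℂ}
    (hz : z ∈ ball (0 : ℂ) 1) (h0 : z ≠ 0) (hw : ‖w‖ ≤ ‖z‖) (hne : w ≠ z) :
    ((z + w) / (z - w)).re < (2 * z * deriv f z / (f z - f w)).re := by
  rcases hw.eq_or_lt with h | h
  · exact re_add_div_sub_lt_of_norm_eq hf hz h0 h hne
  have hf' := hf.1.1.differentiableOn
  have hD := differentiableOn_dslope_ball hf' hz
  have hfz := (hf.2 z hz).1
  -- `N` vanishes at `z`, so `dslope N z` extends minus the difference of the two sides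
  -- holomorphically across `w = z`.
  set N : ℂ → ℂ := fun u => 2 * z * deriv f z / dslope f z u - (z + u) with hN
  set U : Set ℂ := ball 0 1 ∩ dslope f z ⁻¹' {0}ᶜ with hU
  have hUo : IsOpen U := hD.continuousOn.isOpen_inter_preimage isOpen_ball isOpen_compl_singleton
  have hzU : z ∈ U := ⟨hz, by simpa [dslope_same] using hfz⟩
  have hr : ‖z‖ ≠ 0 := norm_ne_zero_iff.mpr h0
  have hsub : closure (ball (0 : ℂ) ‖z‖) ⊆ U := by
    intro u hu
    rw [closure_ball _ hr] at hu
    refine ⟨closedBall_subset_ball (mem_ball_zero_iff.mp hz) hu, ?_⟩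
    by_cases huz : u = z
    · exact huz ▸ hzU.2
    · have h3 := re_sub_mul_conj_neg hf hz h0 (mem_closedBall_zero_iff.mp hu) huz
      rw [Set.mem_preimage, dslope_of_ne _ huz, slope_def_field]
      refine div_ne_zero (fun h => ?_) (sub_ne_zero.mpr huz)
      rw [h] at h3
      simp at h3
  have hNd : DifferentiableOn ℂ N U := by
    refine DifferentiableOn.sub ?_ (by fun_prop)
    exact (differentiableOn_const _).div (hD.mono Set.inter_subset_left) fun u hu => hu.2
  have hG : DiffContOnCl ℂ (dslope N z) (ball 0 ‖z‖) :=
    (((Complex.differentiableOn_dslope (hUo.mem_nhds hzU)).mpr hNd).mono hsub).diffContOnCl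
  have hNz : N z = 0 := by
    simp only [hN, dslope_same]
    field_simp
    ring
  have hGu : ∀ u, u ≠ z → dslope N z u =
      -(2 * z * deriv f z / (f z - f u) - (z + u) / (z - u)) := by
    intro u hu
    have h1 : u - z ≠ 0 := sub_ne_zero.mpr hu
    rw [dslope_of_ne _ hu, slope_def_field, hNz, sub_zero]
    simp only [hN]
    rw [dslope_of_ne _ hu, slope_def_field, ← neg_sub (f u), ← neg_sub u z, div_neg, div_neg]
    rw [div_div_eq_mul_div]
    field_simp
    ring
  have hGz : dslope N z z = -(1 + z * deriv (deriv f) z / deriv f z) := by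
    have hDz := (hD.differentiableAt (isOpen_ball.mem_nhds hz)).hasDerivAt
    rw [deriv_dslope_self hf' hz] at hDz
    have h1 := ((hasDerivAt_const z (2 * z * deriv f z)).div hDz (by rwa [dslope_same])).sub
      ((hasDerivAt_id z).const_add z)
    have h2 : deriv N z = _ := h1.deriv
    rw [dslope_same, h2, dslope_same]
    field_simp
    ring
  have hfin := re_neg_of_sphere hG (a := -z) (fun u hu => by
      by_cases huz : u = z
      · rw [huz, hGz, neg_re]
        linarith [(hf.2 z hz).2]
      · rw [hGu u huz, neg_re, sub_re]
        linarith [re_add_div_sub_lt_of_norm_eq hf hz h0 hu huz]) (norm_neg z) (by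
      rw [hGu _ (neg_ne_self.mpr h0), neg_re, sub_re]
      linarith [re_add_div_sub_lt_of_norm_eq hf hz h0 (norm_neg z) (neg_ne_self.mpr h0)])
    (mem_ball_zero_iff.mpr h)
  rw [hGu w hne, neg_re, sub_re] at hfin
  linarith

/-! ### The two inequalities and their equivalence. -/

theorem bound_eq {ζ : ℂ} (h1 : ζ ≠ 1) : (1 + ζ) / (2 * (1 - ζ)) = 1 / (1 - ζ) - 1 / 2 := by
  have h1'' : 1 - ζ ≠ 0 := sub_ne_zero.mpr h1.symm
  field_simp
  ring

theorem re_bound_eq {ζ : ℂ} (h1 : ζ ≠ 1) :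
    ((1 + ζ) / (2 * (1 - ζ))).re = (1 / (1 - ζ)).re - 1 / 2 := by
  rw [bound_eq h1, sub_re]
  norm_num

theorem re_quotient_eq (ζ a d : ℂ) :
    (1 / (1 - ζ) * (a / d - 1)).re = (a / ((1 - ζ) * d)).re - (1 / (1 - ζ)).re := by
  rw [← sub_re]
  congr 1
  rw [mul_sub, mul_one, div_mul_div_comm, one_mul]

theorem bound_iff {ζ : ℂ} (h1 : ζ ≠ 1) (a d : ℂ) :
    ((1 + ζ) / (2 * (1 - ζ))).re < (a / ((1 - ζ) * d)).re ↔
      -(1 / 2 : ℝ) < (1 / (1 - ζ) * (a / d - 1)).re := by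
  rw [re_bound_eq h1, re_quotient_eq]
  constructor <;> intro h <;> linarith

theorem re_bound_eq_div (ζ : ℂ) :
    ((1 + ζ) / (2 * (1 - ζ))).re = (1 - ‖ζ‖ ^ 2) / (2 * normSq (1 - ζ)) := by
  rw [div_mul_eq_div_div_swap, show (2 : ℂ) = ((2 : ℝ) : ℂ) by norm_num, div_ofReal_re, re_div_eq,
    div_div, mul_comm (normSq _), ← normSq_eq_norm_sq]
  congr 1
  simp [mul_re, normSq_apply]
  ring

theorem zetaDeriv_ne_zero_and_lt {f : ℂ → ℂ} (hf : ClassK f) {z ζ : ℂ}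
    (hz : z ∈ ball (0 : ℂ) 1) (hζ : ‖ζ‖ ≤ 1) (h1 : ζ ≠ 1) :
    zetaDeriv ζ f z ≠ 0 ∧
      ((1 + ζ) / (2 * (1 - ζ))).re < (deriv f z / ((1 - ζ) * zetaDeriv ζ f z)).re := by
  have h1' : 1 - ζ ≠ 0 := sub_ne_zero.mpr h1.symm
  by_cases h0 : z = 0
  · subst h0
    rw [zetaDeriv_zero, hf.1.2.2, mul_one, re_bound_eq h1]
    exact ⟨one_ne_zero, by linarith⟩
  have hw : ‖ζ * z‖ ≤ ‖z‖ := by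
    rw [norm_mul]
    exact mul_le_of_le_one_left (norm_nonneg z) hζ
  have hne : ζ * z ≠ z := fun h => h1 (mul_right_cancel₀ h0 (h.trans (one_mul z).symm))
  have hfne : f z - f (ζ * z) ≠ 0 := by
    intro h
    have h3 := re_sub_mul_conj_neg hf hz h0 hw hne
    rw [← neg_sub, h] at h3
    simp at h3
  rw [zetaDeriv_eq hf.1.1.differentiableOn hz hζ h1 h0]
  refine ⟨div_ne_zero hfne (mul_ne_zero h1' h0), ?_⟩
  have key := re_add_div_sub_lt hf hz h0 hw hne
  have e1 : (z + ζ * z) / (z - ζ * z) = (2 : ℝ) * ((1 + ζ) / (2 * (1 - ζ))) := by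
    rw [show z - ζ * z = (1 - ζ) * z by ring]
    push_cast
    field_simp
  have e2 : 2 * z * deriv f z / (f z - f (ζ * z)) =
      (2 : ℝ) * (deriv f z / ((1 - ζ) * ((f z - f (ζ * z)) / ((1 - ζ) * z)))) := by
    push_cast
    field_simp
  rw [e1, e2, re_ofReal_mul, re_ofReal_mul] at key
  linarith

/-! ### Sharpness for the half-plane mapping. -/

/-- The half-plane mapping `z / (1 - z)`, for which all the bounds are sharp. -/
noncomputable def halfPlaneMap (z : ℂ) : ℂ := z / (1 - z)

theorem one_sub_ne_zero_of_mem_ball {z : ℂ} (hz : z ∈ ball (0 : ℂ) 1) : 1 - z ≠ 0 := by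
  intro h
  rw [mem_ball_zero_iff, ← sub_eq_zero.mp h, norm_one] at hz
  exact lt_irrefl _ hz

theorem deriv_halfPlaneMap {z : ℂ} (hz : z ∈ ball (0 : ℂ) 1) :
    deriv halfPlaneMap z = 1 / (1 - z) ^ 2 := by
  have hne := one_sub_ne_zero_of_mem_ball hz
  have h := (hasDerivAt_id z).div ((hasDerivAt_id z).const_sub 1) hne
  have h2 : deriv halfPlaneMap z = _ := h.deriv
  rw [h2]
  simp only [id_eq]
  congr 1
  ring

theorem deriv_deriv_halfPlaneMap {z : ℂ} (hz : z ∈ ball (0 : ℂ) 1) :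
    deriv (deriv halfPlaneMap) z = 2 / (1 - z) ^ 3 := by
  have hne := one_sub_ne_zero_of_mem_ball hz
  have h1 : deriv halfPlaneMap =ᶠ[𝓝 z] fun u => 1 / (1 - u) ^ 2 := by
    filter_upwards [isOpen_ball.mem_nhds hz] with u hu using deriv_halfPlaneMap hu
  have h := (hasDerivAt_const z (1 : ℂ)).div (((hasDerivAt_id z).const_sub 1).pow 2)
    (pow_ne_zero 2 hne)
  have h2 : deriv (fun u : ℂ => 1 / (1 - u) ^ 2) z = _ := h.deriv
  rw [h1.deriv_eq, h2]
  simp only [id_eq, Pi.pow_apply]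
  field_simp
  norm_num
  ring

theorem neg_half_lt_re_halfPlaneMap {z : ℂ} (hz : z ∈ ball (0 : ℂ) 1) :
    -(1 / 2 : ℝ) < (halfPlaneMap z).re := by
  have hne := one_sub_ne_zero_of_mem_ball hz
  have h : halfPlaneMap z = (1 + z) / (2 * (1 - z)) - (1 / 2 : ℝ) := by
    rw [halfPlaneMap]
    push_cast
    field_simp
    ring
  rw [h, sub_re, re_bound_eq_div, ofReal_re]
  have h1 : ‖z‖ < 1 := mem_ball_zero_iff.mp hz
  have h2 : 0 < normSq (1 - z) := normSq_pos.mpr hne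
  have h3 : 0 < (1 - ‖z‖ ^ 2) / (2 * normSq (1 - z)) :=
    div_pos (by nlinarith [norm_nonneg z]) (by positivity)
  linarith

theorem isGLB_re_halfPlaneMap :
    IsGLB ((fun z : ℂ => (halfPlaneMap z).re) '' ball (0 : ℂ) 1) (-(1 / 2 : ℝ)) := by
  constructor
  · rintro _ ⟨z, hz, rfl⟩
    exact (neg_half_lt_re_halfPlaneMap hz).le
  · intro b hb
    -- The infimum is approached along the radius towards `-1`, at `z = -t`.
    have hlim : Tendsto (fun t : ℝ => -t / (1 + t)) (𝓝[<] 1) (𝓝 (-(1 / 2))) := by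
      have : ContinuousAt (fun t : ℝ => -t / (1 + t)) 1 :=
        ContinuousAt.div (by fun_prop) (by fun_prop) (by norm_num)
      have h := this.tendsto.mono_left (nhdsWithin_le_nhds (s := Set.Iio 1))
      convert! h using 2
      norm_num
    refine ge_of_tendsto hlim ?_
    filter_upwards [Ioo_mem_nhdsLT (show (0 : ℝ) < 1 from one_pos)] with t ht
    refine hb ⟨((-t : ℝ) : ℂ), ?_, ?_⟩
    · rw [mem_ball_zero_iff, norm_real, Real.norm_eq_abs, abs_neg, abs_of_pos ht.1]
      exact ht.2
    · simp only [halfPlaneMap]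
      rw [show ((-t : ℝ) : ℂ) / (1 - ((-t : ℝ) : ℂ)) = ((-t / (1 + t) : ℝ) : ℂ) by push_cast; ring,
        ofReal_re]

theorem mul_deriv_deriv_halfPlaneMap {z : ℂ} (hz : z ∈ ball (0 : ℂ) 1) :
    z * deriv (deriv halfPlaneMap) z / (2 * deriv halfPlaneMap z) = halfPlaneMap z := by
  have hne := one_sub_ne_zero_of_mem_ball hz
  rw [deriv_halfPlaneMap hz, deriv_deriv_halfPlaneMap hz, halfPlaneMap]
  field_simp

theorem differentiableOn_halfPlaneMap : DifferentiableOn ℂ halfPlaneMap (ball 0 1) :=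
  DifferentiableOn.div (by fun_prop) (by fun_prop) fun _ hz => one_sub_ne_zero_of_mem_ball hz

theorem classK_halfPlaneMap : ClassK halfPlaneMap := by
  refine ⟨⟨differentiableOn_halfPlaneMap.analyticOnNhd isOpen_ball, by simp [halfPlaneMap], ?_⟩,
    fun z hz => ?_⟩
  · rw [deriv_halfPlaneMap (mem_ball_self one_pos)]
    norm_num
  · have hne := one_sub_ne_zero_of_mem_ball hz
    have hd : deriv halfPlaneMap z ≠ 0 := by
      rw [deriv_halfPlaneMap hz]
      exact one_div_ne_zero (pow_ne_zero 2 hne)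
    refine ⟨hd, ?_⟩
    have h : 1 + z * deriv (deriv halfPlaneMap) z / deriv halfPlaneMap z =
        1 + (2 : ℝ) * halfPlaneMap z := by
      rw [← mul_deriv_deriv_halfPlaneMap hz]
      push_cast
      field_simp
    rw [h, add_re, re_ofReal_mul, one_re]
    linarith [neg_half_lt_re_halfPlaneMap hz]

theorem quotient_halfPlaneMap {z ζ : ℂ} (hz : z ∈ ball (0 : ℂ) 1) (hζ : ‖ζ‖ ≤ 1) (h1 : ζ ≠ 1) :
    1 / (1 - ζ) * (deriv halfPlaneMap z / zetaDeriv ζ halfPlaneMap z - 1) = halfPlaneMap z := by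
  by_cases h0 : z = 0
  · subst h0
    rw [zetaDeriv_zero, deriv_halfPlaneMap hz]
    simp [halfPlaneMap]
  have hne := one_sub_ne_zero_of_mem_ball hz
  have hne' := one_sub_ne_zero_of_mem_ball (mul_mem_ball hζ hz)
  have h1' : 1 - ζ ≠ 0 := sub_ne_zero.mpr h1.symm
  have hd : zetaDeriv ζ halfPlaneMap z = 1 / ((1 - z) * (1 - ζ * z)) := by
    rw [zetaDeriv_eq differentiableOn_halfPlaneMap hz hζ h1 h0, halfPlaneMap, halfPlaneMap,
      div_sub_div _ _ hne hne', show z * (1 - ζ * z) - (1 - z) * (ζ * z) = (1 - ζ) * z by ring,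
      div_right_comm, div_self (mul_ne_zero h1' h0)]
  rw [hd, deriv_halfPlaneMap hz, halfPlaneMap,
    show 1 / (1 - z) ^ 2 / (1 / ((1 - z) * (1 - ζ * z))) = (1 - ζ * z) / (1 - z) by field_simp,
    div_sub_one hne, show 1 - ζ * z - (1 - z) = (1 - ζ) * z by ring]
  field_simp

theorem isGLB_quotient_halfPlaneMap {ζ : ℂ} (hζ : ‖ζ‖ ≤ 1) (h1 : ζ ≠ 1) :
    IsGLB ((fun z : ℂ => (1 / (1 - ζ) *
        (deriv halfPlaneMap z / zetaDeriv ζ halfPlaneMap z - 1)).re) '' ball (0 : ℂ) 1)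
      (-(1 / 2 : ℝ)) := by
  have h := isGLB_re_halfPlaneMap
  rwa [Set.image_congr fun z hz => by rw [← quotient_halfPlaneMap hz hζ h1]] at h

theorem isGLB_deriv_div_halfPlaneMap {ζ : ℂ} (hζ : ‖ζ‖ ≤ 1) (h1 : ζ ≠ 1) :
    IsGLB ((fun z : ℂ =>
        (deriv halfPlaneMap z / ((1 - ζ) * zetaDeriv ζ halfPlaneMap z)).re) '' ball (0 : ℂ) 1)
      ((1 + ζ) / (2 * (1 - ζ))).re := by
  -- Translation by `Re 1/(1 - ζ)` carries the infimum for (2) to that for (1).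
  have h := (OrderIso.addRight (1 / (1 - ζ)).re).isGLB_image'.mpr
    (isGLB_quotient_halfPlaneMap hζ h1)
  rw [Set.image_image] at h
  convert! h using 1
  · refine Set.image_congr fun z _ => ?_
    rw [re_quotient_eq]
    simp
  · rw [re_bound_eq h1, OrderIso.addRight_apply]
    ring

theorem neg_half_lt_re_limit {f : ℂ → ℂ} (hf : ClassK f) {z : ℂ} (hz : z ∈ ball (0 : ℂ) 1) :
    -(1 / 2 : ℝ) < (z * deriv (deriv f) z / (2 * deriv f z)).re := by
  have h := (hf.2 z hz).2
  rw [mul_comm 2, ← div_div, show (2 : ℂ) = ((2 : ℝ) : ℂ) by norm_num, div_ofReal_re]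
  rw [add_re, one_re] at h
  linarith

end ZetaDerivative

theorem corollaryc50 :
    -- the two inequalities, for `ζ ≠ 1`
    (∀ f : ℂ → ℂ, ZetaDerivative.ClassK f →
      ∀ z ∈ Metric.ball (0 : ℂ) 1, ∀ ζ : ℂ, ‖ζ‖ ≤ 1 → ζ ≠ 1 →
        ZetaDerivative.zetaDeriv ζ f z ≠ 0 ∧
        ((1 + ζ) / (2 * (1 - ζ))).re
          < (deriv f z / ((1 - ζ) * ZetaDerivative.zetaDeriv ζ f z)).re ∧
        -(1 / 2 : ℝ) < (1 / (1 - ζ) * (deriv f z / ZetaDerivative.zetaDeriv ζ f z - 1)).re) ∧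
    -- the sign of the lower bound
    (∀ ζ : ℂ, ‖ζ‖ < 1 → 0 < ((1 + ζ) / (2 * (1 - ζ))).re) ∧
    (∀ ζ : ℂ, ‖ζ‖ = 1 → ζ ≠ 1 → ((1 + ζ) / (2 * (1 - ζ))).re = 0) ∧
    -- the two inequalities are equivalent to each other
    (∀ f : ℂ → ℂ, ZetaDerivative.ClassA f →
      ∀ z ∈ Metric.ball (0 : ℂ) 1, ∀ ζ : ℂ, ‖ζ‖ ≤ 1 → ζ ≠ 1 →
        ZetaDerivative.zetaDeriv ζ f z ≠ 0 →
        (((1 + ζ) / (2 * (1 - ζ))).re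
            < (deriv f z / ((1 - ζ) * ZetaDerivative.zetaDeriv ζ f z)).re ↔
          -(1 / 2 : ℝ)
            < (1 / (1 - ζ) * (deriv f z / ZetaDerivative.zetaDeriv ζ f z - 1)).re)) ∧
    -- the second inequality at the removable singularity `ζ = 1`
    (∀ f : ℂ → ℂ, ZetaDerivative.ClassK f → ∀ z ∈ Metric.ball (0 : ℂ) 1,
      ZetaDerivative.zetaDeriv 1 f z = deriv f z ∧
      Filter.Tendsto
        (fun ζ : ℂ => 1 / (1 - ζ) * (deriv f z / ZetaDerivative.zetaDeriv ζ f z - 1))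
        (nhdsWithin 1 (Metric.closedBall (0 : ℂ) 1 \ {1}))
        (nhds (z * deriv (deriv f) z / (2 * deriv f z))) ∧
      -(1 / 2 : ℝ) < (z * deriv (deriv f) z / (2 * deriv f z)).re) ∧
    -- sharpness: a single function in the class shows that no bound can be increased
    (∃ f : ℂ → ℂ, ZetaDerivative.ClassK f ∧
      (∀ ζ : ℂ, ‖ζ‖ ≤ 1 → ζ ≠ 1 →
        IsGLB ((fun z : ℂ => (deriv f z / ((1 - ζ) * ZetaDerivative.zetaDeriv ζ f z)).re) ''
            Metric.ball (0 : ℂ) 1)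
          ((1 + ζ) / (2 * (1 - ζ))).re ∧
        IsGLB ((fun z : ℂ =>
              (1 / (1 - ζ) * (deriv f z / ZetaDerivative.zetaDeriv ζ f z - 1)).re) ''
            Metric.ball (0 : ℂ) 1)
          (-(1 / 2 : ℝ))) ∧
      IsGLB ((fun z : ℂ => (z * deriv (deriv f) z / (2 * deriv f z)).re) ''
          Metric.ball (0 : ℂ) 1)
        (-(1 / 2 : ℝ))) := by

  refine ⟨fun f hf z hz ζ hζ h1 => ?_, fun ζ hζ => ?_, fun ζ hζ _ => ?_,
    fun f _ z _ ζ _ h1 _ => ZetaDerivative.bound_iff h1 _ _, fun f hf z hz => ?_,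
    ZetaDerivative.halfPlaneMap, ZetaDerivative.classK_halfPlaneMap, fun ζ hζ h1 =>
      ⟨ZetaDerivative.isGLB_deriv_div_halfPlaneMap hζ h1,
        ZetaDerivative.isGLB_quotient_halfPlaneMap hζ h1⟩, ?_⟩
  · have h := ZetaDerivative.zetaDeriv_ne_zero_and_lt hf hz hζ h1
    exact ⟨h.1, h.2, (ZetaDerivative.bound_iff h1 _ _).mp h.2⟩
  · have h1 : 1 - ζ ≠ 0 :=
      ZetaDerivative.one_sub_ne_zero_of_mem_ball (mem_ball_zero_iff.mpr hζ)
    have h2 : 0 < Complex.normSq (1 - ζ) := Complex.normSq_pos.mpr h1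
    rw [ZetaDerivative.re_bound_eq_div]
    exact div_pos (by nlinarith [norm_nonneg ζ]) (by positivity)
  · rw [ZetaDerivative.re_bound_eq_div, hζ]
    norm_num
  · have hd := hf.1.1.differentiableOn
    exact ⟨ZetaDerivative.zetaDeriv_one hd hz,
      ZetaDerivative.tendsto_quotient hd hz (hf.2 z hz).1,
      ZetaDerivative.neg_half_lt_re_limit hf hz⟩
  · have h := ZetaDerivative.isGLB_re_halfPlaneMap
    rwa [Set.image_congr fun z hz => by
      rw [← ZetaDerivative.mul_deriv_deriv_halfPlaneMap hz]] at h
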